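/- Rings are associative and need not be unital; modules are left modules and "ideal" means two-sided ideal. A ring $R$ has \emph{local units} if there is a set $E\subseteq R$ of idempotents such that every finite subset of $R$ is contained in $eRe$ for some $e\in E$. A left module $M$ over such a ring is \emph{unitary} if $RM=M$, and two rings with local units are \emph{Morita equivalent} if their categories of unitary left modules are equivalent. A left $R$-module $M$ is \emph{simple} if $RM\neq 0$ and its only submodules are $0$ and $M$; $R$ is (left) \emph{primitive} if it has a faithful simple left module; $R$ is \emph{simple} if $R^2\neq 0$ and its only ideals are $0$ and $R$. A ring $R$ is (left) \emph{CCR} if every primitive quotient ring $R/I$ (with $I$ an ideal) is simple and has a minimal left ideal, and (left) \emph{GCR} if every primitive quotient ring of $R$ has a minimal left ideal. **Theorem.** Let $R$ and $S$ be Morita equivalent rings with local units. Then $R$ is CCR if and only if $S$ is CCR, and $R$ is GCR if and only if $S$ is GCR. -/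

import Mathlib

universe u v w

open CategoryTheory

namespace NonUnital

/-- A left module over a ring `R` that need not have a unit. -/
class LeftModule (R : Type u) (M : Type v) [NonUnitalRing R] [AddCommGroup M]
    extends SMul R M where
  smul_add' : ∀ (r : R) (m n : M), r • (m + n) = r • m + r • n
  add_smul' : ∀ (r s : R) (m : M), (r + s) • m = r • m + s • m
  mul_smul' : ∀ (r s : R) (m : M), (r * s) • m = r • (s • m)

/-- The regular left module of a ring. -/
instance LeftModule.regular (R : Type u) [NonUnitalRing R] : LeftModule R R where
  smul r m := r * m
  smul_add' := mul_add
  add_smul' := add_mul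
  mul_smul' := mul_assoc

section Modules

variable (R : Type u) [NonUnitalRing R] {M : Type v} [AddCommGroup M] [LeftModule R M]

/-- The additive subgroup `N` of `M` is an `R`-submodule. -/
def IsSubmodule (N : AddSubgroup M) : Prop :=
  ∀ (r : R), ∀ m ∈ N, r • m ∈ N

variable (M)

/-- `RM`: the additive subgroup of `M` generated by all products `r • m`. -/
def ringSMul : AddSubgroup M :=
  AddSubgroup.closure {x : M | ∃ (r : R) (m : M), x = r • m}

/-- `M` is simple: `RM ≠ 0`, and the only submodules of `M` are `0` and `M`. -/
def IsSimple : Prop :=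
  ringSMul R M ≠ ⊥ ∧ ∀ N : AddSubgroup M, IsSubmodule R N → N = ⊥ ∨ N = ⊤

/-- `M` is faithful: only `0` annihilates `M`. -/
def IsFaithful : Prop :=
  ∀ r : R, (∀ m : M, r • m = 0) → r = 0

/-- `M` is unitary: `RM = M`. -/
def IsUnitary : Prop :=
  ringSMul R M = ⊤

end Modules

/-- A homomorphism of left `R`-modules. -/
@[ext]
structure ModuleHom (R : Type u) (M : Type v) (N : Type w) [NonUnitalRing R]
    [AddCommGroup M] [AddCommGroup N] [LeftModule R M] [LeftModule R N]
    extends M →+ N where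
  map_smul' : ∀ (r : R) (m : M), toFun (r • m) = r • toFun m

/-- A unitary left `R`-module with underlying type in universe `w`. -/
structure UnitaryModuleCat (R : Type u) [NonUnitalRing R] : Type (max u (w + 1)) where
  carrier : Type w
  [addCommGroup : AddCommGroup carrier]
  [leftModule : LeftModule R carrier]
  unitary : IsUnitary R carrier

attribute [instance] UnitaryModuleCat.addCommGroup UnitaryModuleCat.leftModule

/-- The category of unitary left `R`-modules and all module homomorphisms between them. -/
instance UnitaryModuleCat.category (R : Type u) [NonUnitalRing R] :
    Category.{w} (UnitaryModuleCat.{u, w} R) where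
  Hom M N := ModuleHom R M.carrier N.carrier
  id M := { toAddMonoidHom := AddMonoidHom.id M.carrier, map_smul' := fun _ _ => rfl }
  comp f g :=
    { toAddMonoidHom := g.toAddMonoidHom.comp f.toAddMonoidHom
      map_smul' := fun r m =>
        (congrArg g.toFun (f.map_smul' r m)).trans (g.map_smul' r (f.toFun m)) }

section Rings

variable (R : Type u) [NonUnitalRing R]

/-- `R` has local units: there is a set `E` of idempotents such that every finite subset of `R`
is contained in `eRe` for some `e ∈ E`. -/
def HasLocalUnits : Prop :=
  ∃ E : Set R, (∀ e ∈ E, e * e = e) ∧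
    ∀ F : Finset R, ∃ e ∈ E, ∀ x ∈ F, ∃ r : R, x = e * r * e

/-- `R` is (left) primitive: it has a faithful simple left module. A simple module `M` satisfies
`Rm = M` for every nonzero `m`, so it is a quotient of `R` and the choice of the universe of `R`
for `M` is no restriction. -/
def IsPrimitive : Prop :=
  ∃ (M : Type u) (_ : AddCommGroup M) (_ : LeftModule R M), IsSimple R M ∧ IsFaithful R M

/-- `R` is a simple ring: `R² ≠ 0`, and the only two-sided ideals of `R` are `0` and `R`. -/
def IsSimpleNonUnitalRing : Prop :=
  (∃ a b : R, a * b ≠ 0) ∧ ∀ I : TwoSidedIdeal R, I = ⊥ ∨ I = ⊤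

/-- `R` has a minimal left ideal: a nonzero left ideal `L` such that the only left ideals
contained in `L` are `0` and `L`. -/
def HasMinimalLeftIdeal : Prop :=
  ∃ L : AddSubgroup R, IsSubmodule R L ∧ L ≠ ⊥ ∧
    ∀ K : AddSubgroup R, IsSubmodule R K → K ≤ L → K = ⊥ ∨ K = L

/-- `R` is (left) CCR: every primitive quotient ring of `R` is simple and has a minimal left
ideal. -/
def IsCCR : Prop :=
  ∀ I : TwoSidedIdeal R, IsPrimitive I.ringCon.Quotient →
    IsSimpleNonUnitalRing I.ringCon.Quotient ∧ HasMinimalLeftIdeal I.ringCon.Quotient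

/-- `R` is (left) GCR: every primitive quotient ring of `R` has a minimal left ideal. -/
def IsGCR : Prop :=
  ∀ I : TwoSidedIdeal R, IsPrimitive I.ringCon.Quotient →
    HasMinimalLeftIdeal I.ringCon.Quotient

end Rings

/-- `R` and `S` are Morita equivalent: their categories of unitary left modules are equivalent.
The modules live in the smallest universe that accommodates both rings. -/
def AreMoritaEquivalent (R : Type u) (S : Type v) [NonUnitalRing R] [NonUnitalRing S] : Prop :=
  Nonempty (UnitaryModuleCat.{u, max u v} R ≌ UnitaryModuleCat.{v, max u v} S)

end NonUnital

/-! Both conditions are read off from the category of unitary modules. Let `M` be simple and `P = R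
/ Ann M`, a primitive ring. If `M` cogenerates `N`, then `Ann M` kills `N`. A minimal left ideal `L`
of `P` is isomorphic to `M` through `p ↦ p • m₀`, so `r • m₀ ↦ r • n`, for `r` over `L`, is a
morphism `M ⟶ N` for every `n : N` (`exists_hom_of_minimal`). Conversely, if `M` is a faithful
simple `P`-module, the orbit maps `p ↦ p • m` show that `M` cogenerates the regular module `P`, and
the image of a nonzero morphism `M ⟶ P` is a minimal left ideal.

Hence GCR means that epimorphisms onto a simple `M` from objects it cogenerates split
(`isGCR_iff_simplesSplit`), and CCR means that each simple object generates what it cogenerates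
(`isCCR_iff_simplesGenerate`). Both properties are phrased in purely categorical terms, so
equivalences preserve them. -/

namespace NonUnital

/-! ### Modules over rings with local units, elementwise -/

section Elementwise

variable {R : Type u} [NonUnitalRing R] {M : Type v} [AddCommGroup M] [LeftModule R M]

lemma smul_add_left (r : R) (m n : M) : r • (m + n) = r • m + r • n :=
  LeftModule.smul_add' r m n

lemma add_smul_left (r s : R) (m : M) : (r + s) • m = r • m + s • m :=
  LeftModule.add_smul' r s m

lemma mul_smul_left (r s : R) (m : M) : (r * s) • m = r • (s • m) :=
  LeftModule.mul_smul' r s m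

variable (R) in
/-- Scalar multiplication as a biadditive map. -/
def smulHom : R →+ M →+ M :=
  AddMonoidHom.mk' (fun r => AddMonoidHom.mk' (fun m => r • m) (smul_add_left r))
    fun r s => AddMonoidHom.ext fun m => add_smul_left r s m

lemma smul_zero_left (r : R) : r • (0 : M) = 0 := map_zero (smulHom R r)

lemma smul_neg_left (r : R) (m : M) : r • (-m) = -(r • m) := map_neg (smulHom R r) m

lemma zero_smul_left (m : M) : (0 : R) • m = 0 :=
  DFunLike.congr_fun (map_zero (smulHom R (M := M))) m

lemma neg_smul_left (r : R) (m : M) : (-r) • m = -(r • m) :=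
  DFunLike.congr_fun (map_neg (smulHom R (M := M)) r) m

lemma sub_smul_left (r s : R) (m : M) : (r - s) • m = r • m - s • m :=
  DFunLike.congr_fun (map_sub (smulHom R (M := M)) r s) m

lemma smul_mem_ringSMul (r : R) (m : M) : r • m ∈ ringSMul R M :=
  AddSubgroup.subset_closure ⟨r, m, rfl⟩

lemma isSubmodule_ringSMul : IsSubmodule R (ringSMul R M) :=
  fun r m _ => smul_mem_ringSMul r m

lemma HasLocalUnits.exists_mul_eq (hR : HasLocalUnits R) (F : Finset R) :
    ∃ e : R, ∀ x ∈ F, e * x = x := by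
  obtain ⟨E, hE, h⟩ := hR
  obtain ⟨e, he, hF⟩ := h F
  refine ⟨e, fun x hx => ?_⟩
  obtain ⟨r, rfl⟩ := hF x hx
  rw [← mul_assoc, ← mul_assoc, hE e he]

lemma HasLocalUnits.exists_smul_eq (hR : HasLocalUnits R) (hM : IsUnitary R M) (m : M) :
    ∃ e : R, e • m = m := by
  classical
  -- The induction carries a finite set of scalars instead of one local unit: finite sets for two
  -- summands can be merged, local units cannot.
  have key : ∀ x ∈ ringSMul R M, ∃ F : Finset R, ∀ e : R, (∀ y ∈ F, e * y = y) → e • x = x := by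
    intro x hx
    induction hx using AddSubgroup.closure_induction with
    | mem x hx =>
      obtain ⟨r, n, rfl⟩ := hx
      exact ⟨{r}, fun e he => by rw [← mul_smul_left, he r (Finset.mem_singleton_self r)]⟩
    | zero => exact ⟨∅, fun e _ => smul_zero_left e⟩
    | add x y _ _ hx hy =>
      obtain ⟨F, hF⟩ := hx
      obtain ⟨G, hG⟩ := hy
      refine ⟨F ∪ G, fun e he => ?_⟩
      rw [smul_add_left, hF e fun y hy => he y (Finset.mem_union_left G hy),
        hG e fun y hy => he y (Finset.mem_union_right F hy)]
    | neg x _ hx =>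
      obtain ⟨F, hF⟩ := hx
      exact ⟨F, fun e he => by rw [smul_neg_left, hF e he]⟩
  obtain ⟨F, hF⟩ := key m (by rw [show ringSMul R M = ⊤ from hM]; trivial)
  obtain ⟨e, he⟩ := hR.exists_mul_eq F
  exact ⟨e, hF e he⟩

lemma isUnitary_of_exists_smul_eq (h : ∀ m : M, ∃ e : R, e • m = m) : IsUnitary R M := by
  refine (AddSubgroup.eq_top_iff' _).2 fun m => ?_
  obtain ⟨e, he⟩ := h m
  exact he ▸ smul_mem_ringSMul e m

lemma IsSimple.isUnitary (h : IsSimple R M) : IsUnitary R M :=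
  (h.2 _ isSubmodule_ringSMul).resolve_left h.1

lemma IsUnitary.isSimple (hM : IsUnitary R M) {x : M} (hx : x ≠ 0)
    (h : ∀ N : AddSubgroup M, IsSubmodule R N → N = ⊥ ∨ N = ⊤) : IsSimple R M := by
  refine ⟨fun h0 => hx ?_, h⟩
  have : x ∈ ringSMul R M := by rw [show ringSMul R M = ⊤ from hM]; trivial
  rwa [h0, AddSubgroup.mem_bot] at this

lemma IsSimple.exists_ne_zero (h : IsSimple R M) : ∃ m : M, m ≠ 0 := by
  by_contra! h0
  exact h.1 ((AddSubgroup.eq_bot_iff_forall _).2 fun x _ => h0 x)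

lemma IsSimple.eq_top (h : IsSimple R M) {N : AddSubgroup M} (hN : IsSubmodule R N) {x : M}
    (hx : x ∈ N) (h0 : x ≠ 0) (y : M) : y ∈ N := by
  rcases h.2 N hN with rfl | rfl
  · exact absurd hx h0
  · trivial

/-- A simple unitary module over a ring with local units is generated by any nonzero element. -/
lemma IsSimple.exists_smul (hR : HasLocalUnits R) (h : IsSimple R M) {x : M} (hx : x ≠ 0)
    (y : M) : ∃ r : R, r • x = y := by
  obtain ⟨e, he⟩ := hR.exists_smul_eq h.isUnitary x
  refine h.eq_top (N := ((smulHom R (M := M)).flip x).range) ?_ ⟨e, he⟩ hx y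
  rintro r _ ⟨s, rfl⟩
  exact ⟨r * s, mul_smul_left r s x⟩

end Elementwise

/-- Transport of a module structure along an additive equivalence. -/
abbrev LeftModule.ofAddEquiv (R : Type u) [NonUnitalRing R] {M : Type v} {N : Type w}
    [AddCommGroup M] [AddCommGroup N] [LeftModule R M] (e : N ≃+ M) : LeftModule R N where
  smul r n := e.symm (r • e n)
  smul_add' r m n := by
    change e.symm (r • e (m + n)) = e.symm (r • e m) + e.symm (r • e n)
    rw [map_add, smul_add_left, map_add]
  add_smul' r s n := by
    change e.symm ((r + s) • e n) = e.symm (r • e n) + e.symm (s • e n)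
    rw [add_smul_left, map_add]
  mul_smul' r s n := by
    change e.symm ((r * s) • e n) = e.symm (r • e (e.symm (s • e n)))
    rw [mul_smul_left, e.apply_symm_apply]

/-- Restriction of scalars along a ring homomorphism. -/
abbrev LeftModule.restrict {R : Type u} {P : Type v} [NonUnitalRing R] [NonUnitalRing P]
    (φ : R →ₙ+* P) (M : Type w) [AddCommGroup M] [LeftModule P M] : LeftModule R M where
  smul r m := φ r • m
  smul_add' r m n := smul_add_left (φ r) m n
  add_smul' r s m := by
    change φ (r + s) • m = φ r • m + φ s • m
    rw [map_add, add_smul_left]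
  mul_smul' r s m := by
    change φ (r * s) • m = φ r • (φ s • m)
    rw [map_mul, mul_smul_left]

/-! ### Subobjects, quotients and epimorphisms of unitary modules -/

namespace UnitaryModuleCat

variable {R : Type u} [NonUnitalRing R]

/-- The additive map underlying a morphism of unitary modules. -/
def app {X Y : UnitaryModuleCat.{u, w} R} (f : X ⟶ Y) : X.carrier →+ Y.carrier :=
  ModuleHom.toAddMonoidHom f

/-- The morphism given by an additive map commuting with the action. -/
def ofHom {X Y : UnitaryModuleCat.{u, w} R} (f : X.carrier →+ Y.carrier)
    (hf : ∀ (r : R) (x : X.carrier), f (r • x) = r • f x) : X ⟶ Y :=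
  ModuleHom.mk f hf

variable {X Y Z : UnitaryModuleCat.{u, w} R}

@[simp] lemma app_ofHom (f : X.carrier →+ Y.carrier) (hf) : app (ofHom f hf) = f := rfl

@[simp] lemma app_id (x : X.carrier) : app (𝟙 X) x = x := rfl

@[simp] lemma app_comp (f : X ⟶ Y) (g : Y ⟶ Z) (x : X.carrier) :
    app (f ≫ g) x = app g (app f x) := rfl

lemma app_smul (f : X ⟶ Y) (r : R) (x : X.carrier) : app f (r • x) = r • app f x :=
  ModuleHom.map_smul' f r x

lemma hom_ext {f g : X ⟶ Y} (h : ∀ x, app f x = app g x) : f = g :=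
  ModuleHom.ext (funext h)

/-- The zero morphism. -/
def zeroHom (X Y : UnitaryModuleCat.{u, w} R) : X ⟶ Y :=
  ofHom 0 fun r _ => (smul_zero_left r).symm

@[simp] lemma app_zeroHom (x : X.carrier) : app (zeroHom X Y) x = 0 := rfl

/-- A submodule of a unitary module over a ring with local units, as a unitary module. -/
def sub (hR : HasLocalUnits R) (X : UnitaryModuleCat.{u, w} R) (K : AddSubgroup X.carrier)
    (hK : IsSubmodule R K) : UnitaryModuleCat.{u, w} R :=
  letI : LeftModule R K :=
    { smul := fun r k => ⟨r • (k : X.carrier), hK r k k.2⟩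
      smul_add' := fun r m n => Subtype.ext (smul_add_left r (m : X.carrier) n)
      add_smul' := fun r s m => Subtype.ext (add_smul_left r s (m : X.carrier))
      mul_smul' := fun r s m => Subtype.ext (mul_smul_left r s (m : X.carrier)) }
  { carrier := K
    unitary := isUnitary_of_exists_smul_eq fun k =>
      (hR.exists_smul_eq X.unitary (k : X.carrier)).imp fun _ he => Subtype.ext he }

/-- The inclusion of a submodule. -/
def subι (hR : HasLocalUnits R) (X : UnitaryModuleCat.{u, w} R) (K : AddSubgroup X.carrier)
    (hK : IsSubmodule R K) : sub hR X K hK ⟶ X :=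
  ofHom (X := sub hR X K hK) K.subtype fun _ _ => rfl

/-- The quotient of a unitary module over a ring with local units by a submodule. -/
def quot (hR : HasLocalUnits R) (X : UnitaryModuleCat.{u, w} R) (K : AddSubgroup X.carrier)
    (hK : IsSubmodule R K) : UnitaryModuleCat.{u, w} R :=
  letI : LeftModule R (X.carrier ⧸ K) :=
    { smul := fun r => QuotientAddGroup.map K K (smulHom R r) fun k hk => hK r k hk
      smul_add' := fun r m n => map_add (QuotientAddGroup.map K K (smulHom R r) _) m n
      add_smul' := fun r s m => by
        induction m using QuotientAddGroup.induction_on with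
        | H m => exact congrArg (QuotientAddGroup.mk (s := K)) (add_smul_left r s m)
      mul_smul' := fun r s m => by
        induction m using QuotientAddGroup.induction_on with
        | H m => exact congrArg (QuotientAddGroup.mk (s := K)) (mul_smul_left r s m) }
  { carrier := X.carrier ⧸ K
    unitary := isUnitary_of_exists_smul_eq fun m => by
      induction m using QuotientAddGroup.induction_on with
      | H m =>
        exact (hR.exists_smul_eq X.unitary m).imp fun _ he =>
          congrArg (QuotientAddGroup.mk (s := K)) he }

/-- The projection to a quotient. -/
def quotπ (hR : HasLocalUnits R) (X : UnitaryModuleCat.{u, w} R) (K : AddSubgroup X.carrier)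
    (hK : IsSubmodule R K) : X ⟶ quot hR X K hK :=
  ofHom (Y := quot hR X K hK) (QuotientAddGroup.mk' K) fun _ _ => rfl

lemma app_quotπ_eq_zero_iff (hR : HasLocalUnits R) {K : AddSubgroup X.carrier}
    {hK : IsSubmodule R K} {x : X.carrier} : app (quotπ hR X K hK) x = 0 ↔ x ∈ K :=
  QuotientAddGroup.eq_zero_iff x

lemma isSubmodule_range (f : X ⟶ Y) : IsSubmodule R (app f).range := by
  rintro r _ ⟨x, rfl⟩
  exact ⟨r • x, app_smul f r x⟩

/-- An epimorphism equalizes the projection onto `Y / range f` with zero, so that quotient vanishes.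
Local units make it unitary, hence an object of the category. -/
lemma epi_iff_surjective (hR : HasLocalUnits R) (f : X ⟶ Y) :
    Epi f ↔ Function.Surjective (app f) := by
  constructor
  · intro hf y
    have h : quotπ hR Y _ (isSubmodule_range f) = zeroHom _ _ := by
      rw [← cancel_epi f]
      exact hom_ext fun x => (app_quotπ_eq_zero_iff hR).2 ⟨x, rfl⟩
    exact (app_quotπ_eq_zero_iff hR).1 (congrArg (fun g => app g y) h)
  · intro hf
    refine ⟨fun g h hgh => hom_ext fun y => ?_⟩
    obtain ⟨x, rfl⟩ := hf y
    exact congrArg (fun g => app g x) hgh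

end UnitaryModuleCat

/-! ### Categorical invariants and their transport along equivalences -/

section Categorical

variable {C : Type*} [Category C] {D : Type*} [Category D]

/-- `M` is nonzero and each morphism to `M` is an epimorphism or zero, phrased without zero
morphisms. -/
def IsSimpleObject (M : C) : Prop :=
  (∃ (X : C) (a b : X ⟶ M), a ≠ b) ∧
    ∀ (X : C) (f : X ⟶ M), Epi f ∨ ∀ (Y : C) (a b : Y ⟶ X), a ≫ f = b ≫ f

/-- The morphisms from `N` to `M` are jointly monic. -/
def Cogenerates (M N : C) : Prop :=
  ∀ (X : C) (a b : X ⟶ N), (∀ f : N ⟶ M, a ≫ f = b ≫ f) → a = b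

/-- The morphisms from `M` to `N` are jointly epic. -/
def Generates (M N : C) : Prop :=
  ∀ (X : C) (a b : N ⟶ X), (∀ f : M ⟶ N, f ≫ a = f ≫ b) → a = b

variable (C) in
/-- Each simple object generates the objects it cogenerates. -/
def SimplesGenerate : Prop :=
  ∀ M : C, IsSimpleObject M → ∀ N : C, Cogenerates M N → Generates M N

variable (C) in
/-- Each simple object is relatively projective for the objects it cogenerates. -/
def SimplesSplit : Prop :=
  ∀ M : C, IsSimpleObject M → ∀ N : C, Cogenerates M N →
    ∀ g : N ⟶ M, Epi g → IsSplitEpi g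

lemma IsSimpleObject.map (e : C ≌ D) {M : C} (hM : IsSimpleObject M) :
    IsSimpleObject (e.functor.obj M) := by
  obtain ⟨⟨X, a, b, hab⟩, h⟩ := hM
  refine ⟨⟨e.functor.obj X, e.functor.map a, e.functor.map b,
    fun h => hab (e.functor.map_injective h)⟩, fun X f => ?_⟩
  -- Up to the counit isomorphism at `X`, the morphism `f` comes from `C` by fullness.
  obtain ⟨f', hf'⟩ := e.functor.map_surjective ((e.counitIso.app X).hom ≫ f)
  have hf : f = (e.counitIso.app X).inv ≫ e.functor.map f' := by rw [hf']; simp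
  rcases h _ f' with hf0 | hf0
  · left
    rw [hf]
    infer_instance
  · right
    intro Y a b
    have := hf0 _ (e.inverse.map a) (e.inverse.map b)
    have h2 := congrArg e.functor.map this
    rw [Functor.map_comp, Functor.map_comp, hf'] at h2
    simpa using h2

lemma Cogenerates.map (e : C ≌ D) {M N : C} (h : Cogenerates M N) :
    Cogenerates (e.functor.obj M) (e.functor.obj N) := by
  intro X a b hab
  obtain ⟨a', ha⟩ := e.functor.map_surjective ((e.counitIso.app X).hom ≫ a)
  obtain ⟨b', hb⟩ := e.functor.map_surjective ((e.counitIso.app X).hom ≫ b)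
  rw [← cancel_epi (e.counitIso.app X).hom, ← ha, ← hb]
  refine congrArg _ (h _ a' b' fun f => e.functor.map_injective ?_)
  rw [Functor.map_comp, Functor.map_comp, ha, hb, Category.assoc, Category.assoc, hab]

lemma Generates.of_map (e : C ≌ D) {M N : C}
    (h : Generates (e.functor.obj M) (e.functor.obj N)) : Generates M N := by
  intro X a b hab
  refine e.functor.map_injective (h _ _ _ fun f => ?_)
  obtain ⟨f, rfl⟩ := e.functor.map_surjective f
  rw [← Functor.map_comp, ← Functor.map_comp, hab]

lemma SimplesGenerate.of_equivalence (e : C ≌ D) (h : SimplesGenerate D) : SimplesGenerate C :=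
  fun _ hM _ hN => (h _ (hM.map e) _ (hN.map e)).of_map e

lemma SimplesSplit.of_equivalence (e : C ≌ D) (h : SimplesSplit D) : SimplesSplit C := by
  intro M hM N hN g hg
  have := h _ (hM.map e) _ (hN.map e) (e.functor.map g) inferInstance
  obtain ⟨s, hs⟩ := e.functor.map_surjective (section_ (e.functor.map g))
  exact ⟨⟨⟨s, e.functor.map_injective (by rw [Functor.map_comp, hs]; simp)⟩⟩⟩

end Categorical
-- Simple and cogenerated objects among unitary modules
namespace UnitaryModuleCat

variable {R : Type u} [NonUnitalRing R]

/-- Submodules are the ranges of morphisms: an inclusion that is epi has full range, and one that is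
zero has range zero. -/
lemma isSimpleObject_iff (hR : HasLocalUnits R) (M : UnitaryModuleCat.{u, w} R) :
    IsSimpleObject M ↔ IsSimple R M.carrier := by
  constructor
  · rintro ⟨⟨X, a, b, hab⟩, h⟩
    obtain ⟨x, hx⟩ : ∃ x, app a x ≠ app b x := by
      by_contra! h0
      exact hab (hom_ext h0)
    refine M.unitary.isSimple (sub_ne_zero.2 hx) fun K hK => ?_
    rcases h _ (subι hR M K hK) with h0 | h0
    · right
      rw [epi_iff_surjective hR] at h0
      refine (AddSubgroup.eq_top_iff' K).2 fun m => ?_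
      obtain ⟨k, rfl⟩ := h0 m
      exact Subtype.property (p := (· ∈ K)) k
    · left
      refine (AddSubgroup.eq_bot_iff_forall K).2 fun m hm => ?_
      exact congrArg (fun g => app g (⟨m, hm⟩ : K)) (h0 _ (𝟙 _) (zeroHom _ _))
  · intro h
    obtain ⟨m, hm⟩ := h.exists_ne_zero
    refine ⟨⟨M, 𝟙 M, zeroHom M M, fun h0 => hm (congrArg (fun g => app g m) h0)⟩,
      fun X f => ?_⟩
    rcases h.2 _ (isSubmodule_range f) with h0 | h0
    · right
      intro Y a b
      have hf : ∀ x, app f x = 0 := fun x => by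
        have : app f x ∈ (app f).range := ⟨x, rfl⟩
        rwa [h0, AddSubgroup.mem_bot] at this
      exact hom_ext fun y => by rw [app_comp, app_comp, hf, hf]
    · left
      rw [epi_iff_surjective hR]
      exact AddMonoidHom.range_eq_top.1 h0

/-- The common kernel of all morphisms `N ⟶ M` vanishes, since its inclusion and zero become equal
after each of them. It contains `r • n` because `f (r • n) = r • f n = 0`. -/
lemma smul_eq_zero_of_cogenerates (hR : HasLocalUnits R) {M N : UnitaryModuleCat.{u, w} R}
    (h : Cogenerates M N) {r : R} (hr : ∀ m : M.carrier, r • m = 0) (n : N.carrier) :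
    r • n = 0 := by
  let K : AddSubgroup N.carrier := ⨅ f : N ⟶ M, (app f).ker
  have hmem : ∀ x : N.carrier, x ∈ K ↔ ∀ f : N ⟶ M, app f x = 0 := fun x => by
    simp only [K, AddSubgroup.mem_iInf, AddMonoidHom.mem_ker]
  have hK : IsSubmodule R K := fun s x hx => (hmem _).2 fun f => by
    rw [app_smul, (hmem x).1 hx f, smul_zero_left]
  have h0 := h _ (subι hR N K hK) (zeroHom _ _) fun f => hom_ext fun x => by
    rw [app_comp, app_comp, app_zeroHom, map_zero]
    exact (hmem _).1 (Subtype.property (p := (· ∈ K)) x) f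
  exact congrArg (fun g => app g (⟨r • n, (hmem _).2 fun f => by rw [app_smul, hr]⟩ : K)) h0

lemma cogenerates_of_exists {M N : UnitaryModuleCat.{u, w} R}
    (h : ∀ n : N.carrier, n ≠ 0 → ∃ f : N ⟶ M, app f n ≠ 0) : Cogenerates M N := by
  intro X a b hab
  refine hom_ext fun x => ?_
  by_contra h0
  obtain ⟨f, hf⟩ := h _ (sub_ne_zero.2 h0)
  rw [map_sub] at hf
  exact hf (sub_eq_zero.2 (congrArg (fun g => app g x) (hab f)))

end UnitaryModuleCat

open UnitaryModuleCat

/-! ### From minimal left ideals to splitting and generation -/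

section Quotient

variable {R : Type u} [NonUnitalRing R] {P : Type v} [NonUnitalRing P] {φ : R →ₙ+* P}

/-- If `M` is a simple module, and `L` is a minimal left ideal of the image `P` of `R` in the
endomorphisms of `M`, then `L` is isomorphic to `M`, so that the cyclic submodules `L n` of the
modules over `P` are images of `M`. -/
lemma exists_hom_of_minimal (hφ : Function.Surjective φ) {M : UnitaryModuleCat.{u, w} R}
    (hM : IsSimple R M.carrier) (hker : ∀ r, φ r = 0 ↔ ∀ m : M.carrier, r • m = 0)
    {L : AddSubgroup P} (hL : IsSubmodule P L) (hL0 : L ≠ ⊥)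
    (hmin : ∀ K : AddSubgroup P, IsSubmodule P K → K ≤ L → K = ⊥ ∨ K = L) :
    ∃ m₀ : M.carrier, (∀ m : M.carrier, ∃ r, φ r ∈ L ∧ r • m₀ = m) ∧
      ∀ N : UnitaryModuleCat.{u, w} R, (∀ r, φ r = 0 → ∀ n : N.carrier, r • n = 0) →
        ∀ n : N.carrier, ∃ s : M ⟶ N, ∀ r, φ r ∈ L → app s (r • m₀) = r • n := by
  obtain ⟨q, hpL, hp0⟩ : ∃ p ∈ L, p ≠ 0 := by
    by_contra! h0
    exact hL0 ((AddSubgroup.eq_bot_iff_forall L).2 h0)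
  obtain ⟨t, rfl⟩ := hφ q
  rw [Ne, hker] at hp0
  push Not at hp0
  obtain ⟨m₀, hm₀⟩ := hp0
  have hmulL : ∀ r s, φ s ∈ L → φ (r * s) ∈ L := fun r s hs => by
    rw [map_mul]; exact hL (φ r) (φ s) hs
  -- `L m₀` is a submodule containing `t • m₀ ≠ 0`, hence all of `M`.
  have hsurj : ∀ m : M.carrier, ∃ r, φ r ∈ L ∧ r • m₀ = m := by
    refine hM.eq_top (N := (L.comap (φ : R →+ P)).map ((smulHom R (M := M.carrier)).flip m₀))
      ?_ ⟨t, hpL, rfl⟩ hm₀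
    rintro r _ ⟨s, hs, rfl⟩
    exact ⟨r * s, hmulL r s hs, mul_smul_left r s m₀⟩
  -- The annihilator of `m₀` in `L` is a left ideal that misses `φ t`, so it is zero by minimality.
  have hinj : ∀ r, φ r ∈ L → r • m₀ = 0 → φ r = 0 := by
    let K : AddSubgroup P := (L.comap (φ : R →+ P) ⊓
      ((smulHom R (M := M.carrier)).flip m₀).ker).map (φ : R →+ P)
    have hK : IsSubmodule P K := by
      rintro q _ ⟨s, ⟨hs, hs0⟩, rfl⟩
      obtain ⟨r, rfl⟩ := hφ q
      refine ⟨r * s, ⟨hmulL r s hs, ?_⟩, map_mul φ r s⟩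
      change (r * s) • m₀ = 0
      rw [mul_smul_left, show s • m₀ = 0 from hs0, smul_zero_left]
    have hKL : K ≤ L := by
      rintro _ ⟨s, ⟨hs, -⟩, rfl⟩
      exact hs
    have hKbot : K = ⊥ := (hmin K hK hKL).resolve_right fun h => by
      have : φ t ∈ K := h ▸ hpL
      obtain ⟨s, ⟨-, hs0⟩, hst⟩ := this
      have h1 : (t - s) • m₀ = 0 := (hker (t - s)).1 (by
        rw [map_sub, sub_eq_zero]; exact hst.symm) m₀
      rw [sub_smul_left, show s • m₀ = 0 from hs0, sub_zero] at h1
      exact hm₀ h1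
    intro r hr hr0
    have : φ r ∈ K := ⟨r, ⟨hr, hr0⟩, rfl⟩
    rwa [hKbot, AddSubgroup.mem_bot] at this
  refine ⟨m₀, hsurj, fun N hN n => ?_⟩
  choose l hlL hl using hsurj
  have hwd : ∀ r s, φ r ∈ L → φ s ∈ L → r • m₀ = s • m₀ → r • n = s • n := by
    intro r s hr hs hrs
    rw [← sub_eq_zero, ← sub_smul_left]
    refine hN _ (hinj _ ?_ ?_) n
    · rw [map_sub]; exact L.sub_mem hr hs
    · rw [sub_smul_left, hrs, sub_self]
  refine ⟨ofHom (AddMonoidHom.mk' (fun m => l m • n) fun x y => ?_) fun r x => ?_,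
    fun r hr => hwd _ _ (hlL _) hr (hl _)⟩
  · rw [← add_smul_left]
    refine hwd _ _ (hlL _) ?_ ?_
    · rw [map_add]; exact L.add_mem (hlL x) (hlL y)
    · rw [add_smul_left, hl, hl, hl]
  · change l (r • x) • n = r • (l x • n)
    rw [← mul_smul_left]
    exact hwd _ _ (hlL _) (hmulL _ _ (hlL x)) (by rw [mul_smul_left, hl, hl])

/-- Lift `m₀` to `n₀`; then `r • m₀ ↦ r • n₀` is a section of `g`. -/
lemma isSplitEpi_of_hasMinimalLeftIdeal (hR : HasLocalUnits R) (hφ : Function.Surjective φ)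
    {M N : UnitaryModuleCat.{u, w} R}
    (hM : IsSimple R M.carrier) (hker : ∀ r, φ r = 0 ↔ ∀ m : M.carrier, r • m = 0)
    (hP : HasMinimalLeftIdeal P) (hN : Cogenerates M N) (g : N ⟶ M) (hg : Epi g) :
    IsSplitEpi g := by
  obtain ⟨L, hL, hL0, hmin⟩ := hP
  obtain ⟨m₀, hm₀, h⟩ := exists_hom_of_minimal hφ hM hker hL hL0 hmin
  rw [epi_iff_surjective hR] at hg
  obtain ⟨n₀, hn₀⟩ := hg m₀
  obtain ⟨s, hs⟩ := h N (fun r hr => smul_eq_zero_of_cogenerates hR hN ((hker r).1 hr)) n₀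
  refine ⟨⟨⟨s, hom_ext fun m => ?_⟩⟩⟩
  obtain ⟨r, hr, rfl⟩ := hm₀ m
  rw [app_comp, hs r hr, app_smul, hn₀, app_id]

/-- If `a` and `b` agree on every image of `M`, the scalars `p` with `a = b` on `p N` form a
two-sided ideal containing `L`. Simplicity makes it all of `P`, and local units then give `a = b`.
-/
lemma generates_of_isSimpleNonUnitalRing (hR : HasLocalUnits R) (hφ : Function.Surjective φ)
    {M N : UnitaryModuleCat.{u, w} R}
    (hM : IsSimple R M.carrier) (hker : ∀ r, φ r = 0 ↔ ∀ m : M.carrier, r • m = 0)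
    (hP : IsSimpleNonUnitalRing P) (hP' : HasMinimalLeftIdeal P) (hN : Cogenerates M N) :
    Generates M N := by
  obtain ⟨L, hL, hL0, hmin⟩ := hP'
  obtain ⟨m₀, hm₀, h⟩ := exists_hom_of_minimal hφ hM hker hL hL0 hmin
  have hN0 : ∀ r, φ r = 0 → ∀ n : N.carrier, r • n = 0 := fun r hr =>
    smul_eq_zero_of_cogenerates hR hN ((hker r).1 hr)
  intro X a b hab
  -- Quantifying over all lifts `r` of `p` is harmless: the kernel of `φ` kills `N`.
  let J : TwoSidedIdeal P := TwoSidedIdeal.mk'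
    {p | ∀ r, φ r = p → ∀ n : N.carrier, app a (r • n) = app b (r • n)}
    (fun r hr n => by rw [hN0 r hr n, map_zero, map_zero])
    (by
      intro x y hx hy r hr n
      obtain ⟨s, rfl⟩ := hφ x
      have h1 := hx s rfl n
      have h2 := hy (r - s) (by rw [map_sub, hr, add_sub_cancel_left]) n
      rw [← sub_add_cancel r s, add_smul_left, map_add, map_add, h1, h2])
    (by
      intro x hx r hr n
      have h1 := hx (-r) (by rw [map_neg, hr, neg_neg]) n
      rwa [neg_smul_left, map_neg, map_neg, neg_inj] at h1)
    (by
      intro x y hy r hr n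
      obtain ⟨s, rfl⟩ := hφ x
      obtain ⟨t, rfl⟩ := hφ y
      have h1 : r • n = (s * t) • n := by
        rw [← sub_eq_zero, ← sub_smul_left]
        exact hN0 _ (by rw [map_sub, hr, map_mul, sub_self]) n
      rw [h1, mul_smul_left, app_smul, app_smul b, hy t rfl n])
    (by
      intro x y hx r hr n
      obtain ⟨s, rfl⟩ := hφ x
      obtain ⟨t, rfl⟩ := hφ y
      have h1 : r • n = (s * t) • n := by
        rw [← sub_eq_zero, ← sub_smul_left]
        exact hN0 _ (by rw [map_sub, hr, map_mul, sub_self]) n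
      rw [h1, mul_smul_left, hx s rfl])
  have hJ : ∀ p, p ∈ J ↔ ∀ r, φ r = p → ∀ n : N.carrier, app a (r • n) = app b (r • n) :=
    fun p => TwoSidedIdeal.mem_mk' _ _ _ _ _ _ p
  have hJtop : J = ⊤ := (hP.2 J).resolve_left fun hJbot => hL0 <|
    (AddSubgroup.eq_bot_iff_forall L).2 fun p hp => by
      have : p ∈ J := (hJ p).2 fun r hr n => by
        obtain ⟨s, hs⟩ := h N hN0 n
        rw [← hs r (hr ▸ hp)]
        exact congrArg (fun g => app g (r • m₀)) (hab s)
      rwa [hJbot, TwoSidedIdeal.mem_bot] at this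
  refine hom_ext fun n => ?_
  obtain ⟨e, he⟩ := hR.exists_smul_eq N.unitary n
  rw [← he]
  exact (hJ (φ e)).1 (hJtop ▸ trivial) e rfl n

end Quotient

/-! ### Modules over an image of `R`, moved to a larger universe -/

section Regular

variable {R : Type u} [NonUnitalRing R] {P : Type u} [NonUnitalRing P]

/-- A module over an image of `R`, in a larger universe and as a module over `R`. -/
def liftModule (φ : R →ₙ+* P) (M : Type u) [AddCommGroup M] [LeftModule P M]
    (h : ∀ m : M, ∃ e : R, φ e • m = m) : UnitaryModuleCat.{u, max u w} R :=
  letI : LeftModule R M := LeftModule.restrict φ M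
  letI : LeftModule R (ULift.{w} M) := LeftModule.ofAddEquiv R AddEquiv.ulift
  { carrier := ULift.{w} M
    unitary := isUnitary_of_exists_smul_eq fun m =>
      (h m.down).imp fun _ he => ULift.down_injective he }

variable {φ : R →ₙ+* P} {M : Type u} [AddCommGroup M] [LeftModule P M]
    {h : ∀ m : M, ∃ e : R, φ e • m = m}

/-- The additive identification of `liftModule φ M h` with `M`. -/
def liftModuleEquiv : (liftModule.{u, w} φ M h).carrier ≃+ M := AddEquiv.ulift

lemma liftModuleEquiv_smul (r : R) (m : (liftModule.{u, w} φ M h).carrier) :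
    liftModuleEquiv (r • m) = φ r • liftModuleEquiv m := rfl

lemma isSimple_liftModule (hφ : Function.Surjective φ) (hM : IsSimple P M) :
    IsSimple R (liftModule.{u, w} φ M h).carrier := by
  obtain ⟨m, hm⟩ := hM.exists_ne_zero
  let e : (liftModule.{u, w} φ M h).carrier ≃+ M := liftModuleEquiv
  refine (liftModule.{u, w} φ M h).unitary.isSimple
    ((map_ne_zero_iff e.symm e.symm.injective).2 hm) fun K hK => ?_
  have hK' : IsSubmodule P (K.map (e : _ →+ M)) := by
    rintro p _ ⟨k, hk, rfl⟩
    obtain ⟨r, rfl⟩ := hφ p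
    exact ⟨r • k, hK r k hk, liftModuleEquiv_smul r k⟩
  rcases hM.2 _ hK' with h0 | h0
  · left
    exact (AddSubgroup.map_eq_bot_iff_of_injective K e.injective).1 h0
  · right
    refine (AddSubgroup.eq_top_iff' K).2 fun x => ?_
    obtain ⟨k, hk, hkx⟩ : e x ∈ K.map (e : _ →+ M) := h0 ▸ trivial
    exact e.injective hkx ▸ hk

end Regular

lemma HasLocalUnits.of_surjective {R : Type u} [NonUnitalRing R] {P : Type v} [NonUnitalRing P]
    {φ : R →ₙ+* P} (hφ : Function.Surjective φ) (hR : HasLocalUnits R) : HasLocalUnits P := by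
  classical
  obtain ⟨E, hE, h⟩ := hR
  refine ⟨φ '' E, ?_, fun F => ?_⟩
  · rintro _ ⟨e, he, rfl⟩
    rw [← map_mul, hE e he]
  · obtain ⟨e, he, hF⟩ := h (F.image (Function.surjInv hφ))
    refine ⟨φ e, ⟨e, he, rfl⟩, fun x hx => ?_⟩
    obtain ⟨r, hr⟩ := hF _ (Finset.mem_image_of_mem _ hx)
    exact ⟨φ r, by rw [← map_mul, ← map_mul, ← hr, Function.surjInv_eq hφ]⟩

/-! ### From splitting and generation to minimal left ideals -/

section Regular

variable {R : Type u} [NonUnitalRing R] {P : Type u} [NonUnitalRing P] {φ : R →ₙ+* P}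

lemma HasLocalUnits.exists_map_smul_eq (hφ : Function.Surjective φ) (hR : HasLocalUnits R)
    {M : Type u} [AddCommGroup M] [LeftModule P M] (hM : IsUnitary P M) (m : M) :
    ∃ e : R, φ e • m = m := by
  obtain ⟨p, hp⟩ := (hR.of_surjective hφ).exists_smul_eq hM m
  obtain ⟨e, rfl⟩ := hφ p
  exact ⟨e, hp⟩

lemma HasLocalUnits.isUnitary_regular (hR : HasLocalUnits R) : IsUnitary R R :=
  isUnitary_of_exists_smul_eq fun x =>
    (hR.exists_mul_eq {x}).imp fun _ he => he x (Finset.mem_singleton_self x)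

variable {M : Type u} [AddCommGroup M] [LeftModule P M] {h : ∀ m : M, ∃ e : R, φ e • m = m}
  {h' : ∀ p : P, ∃ e : R, φ e • p = p}

/-- The morphism `p ↦ p • m`. -/
def orbitHom (m : M) : liftModule.{u, w} φ P h' ⟶ liftModule.{u, w} φ M h :=
  ofHom (liftModuleEquiv.symm.toAddMonoidHom.comp
      (((smulHom P (M := M)).flip m).comp (liftModuleEquiv (h := h')).toAddMonoidHom)) fun r x =>
    liftModuleEquiv.injective (mul_smul_left (φ r) (liftModuleEquiv x) m)

lemma liftModuleEquiv_orbitHom (m : M) (p : (liftModule.{u, w} φ P h').carrier) :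
    liftModuleEquiv (app (orbitHom (h := h) m) p) = liftModuleEquiv p • m := rfl

/-- By faithfulness a nonzero `p` moves some `m`, so the orbit map of `m` does not kill `p`. -/
lemma cogenerates_regular (hf : IsFaithful P M) :
    Cogenerates (liftModule.{u, w} φ M h) (liftModule.{u, w} φ P h') := by
  refine cogenerates_of_exists fun p hp => ?_
  have hp' : liftModuleEquiv p ≠ 0 := (map_ne_zero_iff _ liftModuleEquiv.injective).2 hp
  by_contra! h0
  refine hp' (hf _ fun m => ?_)
  rw [← liftModuleEquiv_orbitHom (h := h), h0, map_zero]

/-- The image of a simple module under a nonzero morphism has no proper nonzero submodules, and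
submodules of `P` are left ideals. -/
lemma hasMinimalLeftIdeal_of_hom (hφ : Function.Surjective φ) {X : UnitaryModuleCat.{u, max u w} R}
    (hX : IsSimple R X.carrier) (s : X ⟶ liftModule.{u, w} φ P h') (hs : ∃ x, app s x ≠ 0) :
    HasMinimalLeftIdeal P := by
  obtain ⟨x, hx⟩ := hs
  let t : X.carrier →+ P := (liftModuleEquiv (h := h')).toAddMonoidHom.comp (app s)
  have ht : ∀ r y, t (r • y) = φ r * t y := fun r y =>
    congrArg liftModuleEquiv (app_smul s r y)
  refine ⟨t.range, ?_, fun h0 => hx ?_, fun K hK hKt => ?_⟩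
  · rintro p _ ⟨y, rfl⟩
    obtain ⟨r, rfl⟩ := hφ p
    exact ⟨r • y, ht r y⟩
  · have : t x ∈ t.range := ⟨x, rfl⟩
    rw [h0, AddSubgroup.mem_bot] at this
    exact (map_eq_zero_iff liftModuleEquiv liftModuleEquiv.injective).1 this
  · have hK' : IsSubmodule R (K.comap t) := fun r y hy => by
      rw [AddSubgroup.mem_comap, ht]
      exact hK (φ r) (t y) hy
    rcases hX.2 _ hK' with h0 | h0
    · left
      refine (AddSubgroup.eq_bot_iff_forall K).2 fun k hk => ?_
      obtain ⟨y, rfl⟩ := hKt hk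
      have : y ∈ K.comap t := hk
      rw [h0, AddSubgroup.mem_bot] at this
      rw [this, map_zero]
    · right
      refine le_antisymm hKt ?_
      rintro _ ⟨y, rfl⟩
      have : y ∈ K.comap t := h0 ▸ trivial
      exact this

lemma IsSimple.exists_scalar_ne_zero (hM : IsSimple P M) :
    ∃ p : P, p ≠ 0 := by
  by_contra! h0
  refine hM.1 (AddSubgroup.closure_eq_bot_iff.2 ?_)
  rintro _ ⟨p, m, rfl⟩
  rw [h0 p, zero_smul_left]
  exact Set.mem_singleton _

/-- The orbit map of a nonzero `m` is an epimorphism from `P` onto the faithful simple module; a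
section of it is a nonzero morphism back into `P`. -/
lemma hasMinimalLeftIdeal_of_simplesSplit (hR : HasLocalUnits R) (hφ : Function.Surjective φ)
    (hC : SimplesSplit (UnitaryModuleCat.{u, max u w} R)) (hP : IsPrimitive P) :
    HasMinimalLeftIdeal P := by
  obtain ⟨M, _, _, hM, hf⟩ := hP
  have h := hR.exists_map_smul_eq hφ hM.isUnitary
  have h' := hR.exists_map_smul_eq hφ (hR.of_surjective hφ).isUnitary_regular
  obtain ⟨m, hm⟩ := hM.exists_ne_zero
  have hX : IsSimple R (liftModule.{u, w} φ M h).carrier := isSimple_liftModule hφ hM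
  let g : liftModule.{u, w} φ P h' ⟶ liftModule.{u, w} φ M h := orbitHom m
  have hg : Epi g := by
    rw [epi_iff_surjective hR]
    intro y
    obtain ⟨p, hp⟩ := hM.exists_smul (hR.of_surjective hφ) hm (liftModuleEquiv y)
    exact ⟨liftModuleEquiv.symm p, liftModuleEquiv.injective hp⟩
  have := hC _ ((isSimpleObject_iff hR _).2 hX) _ (cogenerates_regular hf) g hg
  obtain ⟨x, hx⟩ := hX.exists_ne_zero
  refine hasMinimalLeftIdeal_of_hom hφ hX (section_ g) ⟨x, fun h0 => hx ?_⟩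
  have := congrArg (fun f => app f x) (IsSplitEpi.id g)
  simp only [app_comp, h0, map_zero, app_id] at this
  exact this.symm

lemma isSimple_and_hasMinimalLeftIdeal_of_simplesGenerate (hR : HasLocalUnits R)
    (hφ : Function.Surjective φ)
    (hC : SimplesGenerate (UnitaryModuleCat.{u, max u w} R)) (hP : IsPrimitive P) :
    IsSimpleNonUnitalRing P ∧ HasMinimalLeftIdeal P := by
  obtain ⟨M, _, _, hM, hf⟩ := hP
  have h := hR.exists_map_smul_eq hφ hM.isUnitary
  have h' := hR.exists_map_smul_eq hφ (hR.of_surjective hφ).isUnitary_regular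
  have hX : IsSimple R (liftModule.{u, w} φ M h).carrier := isSimple_liftModule hφ hM
  have hgen := hC _ ((isSimpleObject_iff hR _).2 hX) _ (cogenerates_regular (h' := h') hf)
  obtain ⟨p, hp⟩ := hM.exists_scalar_ne_zero
  refine ⟨⟨?_, fun J => ?_⟩, ?_⟩
  · obtain ⟨e, he⟩ := h' p
    exact ⟨φ e, p, fun h0 => hp (he.symm.trans h0)⟩
  · refine or_iff_not_imp_left.2 fun hJ => ?_
    obtain ⟨j, hj, hj0⟩ : ∃ j ∈ J, j ≠ 0 := by
      by_contra! h0
      exact hJ (le_bot_iff.1 fun x hx => (TwoSidedIdeal.mem_bot P).2 (h0 x hx))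
    let K : AddSubgroup (liftModule.{u, w} φ P h').carrier :=
      (AddSubgroup.mk (AddSubmonoid.mk (AddSubsemigroup.mk (J : Set P) J.add_mem) J.zero_mem)
        J.neg_mem).comap (liftModuleEquiv (h := h')).toAddMonoidHom
    have hmem : ∀ x, x ∈ K ↔ liftModuleEquiv x ∈ J := fun _ => Iff.rfl
    have hK : IsSubmodule R K := fun r x hx => J.mul_mem_left (φ r) _ hx
    -- Every `s : M ⟶ P` lands in `J`: choosing `m` with `j • m ≠ 0`, one has `s (j • m) = j * s m ∈
    -- J`, so the preimage of `J` is a nonzero submodule of `M`. As `M` generates `P`, the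
    -- projection `P ⟶ P / J` is zero.
    have key := hgen _ (quotπ hR _ K hK) (zeroHom _ _) fun s => hom_ext fun x => by
      refine (app_quotπ_eq_zero_iff hR).2 ?_
      obtain ⟨r, rfl⟩ := hφ j
      obtain ⟨m, hm⟩ : ∃ m : M, φ r • m ≠ 0 := by
        by_contra! h0
        exact hj0 (hf _ h0)
      refine hX.eq_top (N := K.comap (app s)) (fun t y hy => ?_)
        (x := r • liftModuleEquiv.symm m) ?_ ?_ x
      · rw [AddSubgroup.mem_comap, app_smul]
        exact hK t _ hy
      · rw [AddSubgroup.mem_comap, app_smul]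
        exact J.mul_mem_right _ _ hj
      · exact fun h0 => hm (congrArg liftModuleEquiv h0)
    refine top_le_iff.1 fun q _ => ?_
    exact (app_quotπ_eq_zero_iff hR).1
      (congrArg (fun f => app f (liftModuleEquiv.symm q)) key)
  -- If all morphisms `M ⟶ P` were zero, generation would identify the identity of `P` with zero.
  · obtain ⟨s, hs⟩ : ∃ s : liftModule.{u, w} φ M h ⟶ liftModule.{u, w} φ P h',
        ∃ x, app s x ≠ 0 := by
      by_contra! h0
      have := hgen _ (𝟙 _) (zeroHom _ _) fun s => hom_ext fun x => h0 s x
      exact hp (congrArg (fun f => liftModuleEquiv (app f (liftModuleEquiv.symm p))) this)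
    exact hasMinimalLeftIdeal_of_hom hφ hX s hs

/-- The image of `R` in the endomorphisms of a simple module is primitive. -/
lemma isPrimitive_of_isSimple (hR : HasLocalUnits R) (hφ : Function.Surjective φ)
    {M : UnitaryModuleCat.{u, w} R} (hM : IsSimple R M.carrier)
    (hker : ∀ r, φ r = 0 ↔ ∀ m : M.carrier, r • m = 0) : IsPrimitive P := by
  obtain ⟨x, hx⟩ := hM.exists_ne_zero
  -- `M` is the image of `R` under `r ↦ r • x`, so it has a copy in the universe that `IsPrimitive`
  -- requires.
  have : Small.{u} M.carrier := small_of_surjective (hM.exists_smul hR hx)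
  have hwd : ∀ r s, φ r = φ s → ∀ m : M.carrier, r • m = s • m := fun r s hrs m => by
    rw [← sub_eq_zero, ← sub_smul_left]
    exact (hker _).1 (by rw [map_sub, hrs, sub_self]) m
  let l : P → R := Function.surjInv hφ
  have hl : ∀ p, φ (l p) = p := Function.surjInv_eq hφ
  let _ : LeftModule P M.carrier :=
    { smul := fun p m => l p • m
      smul_add' := fun p m n => smul_add_left (l p) m n
      add_smul' := fun p q m =>
        (hwd _ _ (by rw [map_add, hl, hl, hl]) m).trans (add_smul_left (l p) (l q) m)
      mul_smul' := fun p q m =>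
        (hwd _ _ (by rw [map_mul, hl, hl, hl]) m).trans (mul_smul_left (l p) (l q) m) }
  let e : Shrink.{u} M.carrier ≃+ M.carrier := Shrink.addEquiv
  let _ : LeftModule P (Shrink.{u} M.carrier) := LeftModule.ofAddEquiv P e
  have he : ∀ (r : R) (m : Shrink.{u} M.carrier), e (φ r • m) = r • e m := fun r m =>
    (e.apply_symm_apply _).trans (hwd _ _ (hl _) _)
  have hx' : e.symm x ≠ 0 := (map_ne_zero_iff e.symm e.symm.injective).2 hx
  have hU : IsUnitary P (Shrink.{u} M.carrier) := isUnitary_of_exists_smul_eq fun m => by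
    obtain ⟨r, hr⟩ := hR.exists_smul_eq M.unitary (e m)
    exact ⟨φ r, e.injective ((he r m).trans hr)⟩
  refine ⟨_, inferInstance, inferInstance, hU.isSimple hx' fun K hK => ?_, fun p hp => ?_⟩
  · have hK' : IsSubmodule R (K.map (e : _ →+ M.carrier)) := by
      rintro r _ ⟨k, hk, rfl⟩
      exact ⟨φ r • k, hK _ k hk, he r k⟩
    rcases hM.2 _ hK' with h0 | h0
    · left
      exact (AddSubgroup.map_eq_bot_iff_of_injective K e.injective).1 h0
    · right
      refine (AddSubgroup.eq_top_iff' K).2 fun y => ?_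
      obtain ⟨k, hk, hky⟩ : e y ∈ K.map (e : _ →+ M.carrier) := h0 ▸ trivial
      exact e.injective hky ▸ hk
  · obtain ⟨r, rfl⟩ := hφ p
    refine (hker r).2 fun m => ?_
    rw [← e.apply_symm_apply m, ← he]
    exact (congrArg e (hp _)).trans (map_zero e)

end Regular

/-! ### CCR and GCR as categorical properties -/

section Invariants

variable {R : Type u} [NonUnitalRing R]

/-- The projection of a ring onto its quotient by an ideal. -/
def quotientHom (I : TwoSidedIdeal R) : R →ₙ+* I.ringCon.Quotient where
  toFun r := r
  map_mul' _ _ := rfl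
  map_zero' := rfl
  map_add' _ _ := rfl

lemma quotientHom_surjective (I : TwoSidedIdeal R) : Function.Surjective (quotientHom I) :=
  Quotient.exists_rep

lemma quotientHom_eq_zero_iff (I : TwoSidedIdeal R) (r : R) : quotientHom I r = 0 ↔ r ∈ I :=
  I.ringCon.eq

/-- The annihilator of a module. -/
def annihilator (R : Type u) [NonUnitalRing R] (M : Type v) [AddCommGroup M] [LeftModule R M] :
    TwoSidedIdeal R :=
  TwoSidedIdeal.mk' {r | ∀ m : M, r • m = 0} zero_smul_left
    (fun {x y} hx hy m => by rw [add_smul_left, hx, hy, add_zero])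
    (fun {x} hx m => by rw [neg_smul_left, hx, neg_zero])
    (fun {x y} hy m => by rw [mul_smul_left, hy, smul_zero_left])
    (fun {x y} hx m => by rw [mul_smul_left, hx])

lemma quotientHom_annihilator_eq_zero_iff (M : UnitaryModuleCat.{u, w} R) (r : R) :
    quotientHom (annihilator R M.carrier) r = 0 ↔ ∀ m : M.carrier, r • m = 0 :=
  (quotientHom_eq_zero_iff _ r).trans (TwoSidedIdeal.mem_mk' _ _ _ _ _ _ r)

/-- The universe `w` is free, so that two rings in different universes can be tested on modules in a
common one. -/
theorem isGCR_iff_simplesSplit (hR : HasLocalUnits R) :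
    IsGCR R ↔ SimplesSplit (UnitaryModuleCat.{u, max u w} R) := by
  refine ⟨fun h M hM N hN g hg => ?_, fun h I hI =>
    hasMinimalLeftIdeal_of_simplesSplit hR (quotientHom_surjective I) h hI⟩
  rw [isSimpleObject_iff hR] at hM
  have hφ := quotientHom_surjective (annihilator R M.carrier)
  have hker := quotientHom_annihilator_eq_zero_iff M
  exact isSplitEpi_of_hasMinimalLeftIdeal hR hφ hM hker
    (h _ (isPrimitive_of_isSimple hR hφ hM hker)) hN g hg

theorem isCCR_iff_simplesGenerate (hR : HasLocalUnits R) :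
    IsCCR R ↔ SimplesGenerate (UnitaryModuleCat.{u, max u w} R) := by
  refine ⟨fun h M hM N hN => ?_, fun h I hI =>
    isSimple_and_hasMinimalLeftIdeal_of_simplesGenerate hR (quotientHom_surjective I) h hI⟩
  rw [isSimpleObject_iff hR] at hM
  have hφ := quotientHom_surjective (annihilator R M.carrier)
  have hker := quotientHom_annihilator_eq_zero_iff M
  obtain ⟨h1, h2⟩ := h _ (isPrimitive_of_isSimple hR hφ hM hker)
  exact generates_of_isSimpleNonUnitalRing hR hφ hM hker h1 h2 hN

end Invariants

end NonUnital

theorem theoremt {R : Type u} {S : Type v} [NonUnitalRing R] [NonUnitalRing S]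
    (hR : NonUnital.HasLocalUnits R) (hS : NonUnital.HasLocalUnits S)
    (h : NonUnital.AreMoritaEquivalent R S) :
    (NonUnital.IsCCR R ↔ NonUnital.IsCCR S) ∧ (NonUnital.IsGCR R ↔ NonUnital.IsGCR S) := by
  obtain ⟨e⟩ := h
  rw [NonUnital.isCCR_iff_simplesGenerate.{u, v} hR, NonUnital.isCCR_iff_simplesGenerate.{v, u} hS,
    NonUnital.isGCR_iff_simplesSplit.{u, v} hR, NonUnital.isGCR_iff_simplesSplit.{v, u} hS]
  exact ⟨⟨.of_equivalence e.symm, .of_equivalence e⟩, ⟨.of_equivalence e.symm, .of_equivalence e⟩⟩
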